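/- Let $\mathfrak A$ be a C*-algebra (unital or not), with state space $\mathscr S(\mathfrak A)$ (positive linear functionals of norm $1$) and self-adjoint part $\mathfrak{sa}(\mathfrak A)$. Let $\mathfrak{uA}$ be the smallest unital C*-algebra containing $\mathfrak A$ ($\mathfrak A$ itself if it is unital, its standard unitization otherwise), with unit $1$; each state of $\mathfrak A$ is identified with its unique extension to a state of $\mathfrak{uA}$ and with the normal state it defines on the enveloping von Neumann algebra $\mathfrak A^{**}$. A *Lipschitz triple* $(\mathfrak A,\mathsf L,\mathfrak M)$ consists of $\mathfrak A$, a seminorm $\mathsf L$ defined on a norm dense real subspace of $\mathfrak{sa}(\mathfrak{uA})$ with $\{a : \mathsf L(a)=0\}=\mathbb R 1$, and an Abelian C*-subalgebra $\mathfrak M$ of $\mathfrak A$ which contains an approximate identity for $\mathfrak A$. Let $\sigma(\mathfrak M)$ be the Gelfand spectrum of $\mathfrak M$ with the weak* topology, and for a compact $K\subseteq\sigma(\mathfrak M)$ let $\chi_K\in\mathfrak M^{**}\subseteq\mathfrak A^{**}$ be the indicator function of $K$. A *local state* is a state $\mu$ of $\mathfrak A$ with $\mu(\chi_K)=1$ for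 some compact $K\subseteq\sigma(\mathfrak M)$. A set $\mathscr K\subseteq\mathscr S(\mathfrak A)$ is *tame* when, for some local state $\mu$, $$\lim_{K}\ \sup\{|\varphi(a-\chi_K a\chi_K)| : a\in\mathfrak{sa}(\mathfrak{uA}),\ \mathsf L(a)\le 1,\ \mu(a)=0,\ \varphi\in\mathscr K\}=0,$$ the limit being taken over the compact subsets $K$ of $\sigma(\mathfrak M)$ directed by inclusion. It is *tight* when for every $\varepsilon>0$ there is a compact $Q\subseteq\sigma(\mathfrak M)$ such that $\sup\{\varphi(1-\chi_K):\varphi\in\mathscr K\}<\varepsilon$ for every compact $K\subseteq\sigma(\mathfrak M)$ with $Q\subseteq K$. **Theorem.** Let $(\mathfrak A,\mathsf L,\mathfrak M)$ be a Lipschitz triple and let $\mathscr K\subseteq\mathscr S(\mathfrak A)$ be tame. Then $\mathscr K$ is tight. In particular, the closure of $\mathscr K$ in $\mathfrak A^*$ for the weak* topology $\sigma(\mathfrak A^*,\mathfrak A)$ is weak* compact and contained in $\mathscr S(\mathfrak A)$. -/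

import Mathlib

open Filter Topology
open scoped ENNReal ComplexOrder

namespace QuantumMetric

/-! ## The bidual of a C*-algebra -/

/-- The topological bidual of `A`, with its norm. -/
def Bidual (A : Type*) [NonUnitalCStarAlgebra A] : Type _ :=
  StrongDual ℂ (StrongDual ℂ A)

section Bidual

variable {A : Type*} [NonUnitalCStarAlgebra A]

noncomputable instance : NormedAddCommGroup (Bidual A) :=
  inferInstanceAs (NormedAddCommGroup (StrongDual ℂ (StrongDual ℂ A)))

noncomputable instance : NormedSpace ℂ (Bidual A) :=
  inferInstanceAs (NormedSpace ℂ (StrongDual ℂ (StrongDual ℂ A)))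

noncomputable instance : FunLike (Bidual A) (StrongDual ℂ A) ℂ :=
  inferInstanceAs (FunLike (StrongDual ℂ (StrongDual ℂ A)) (StrongDual ℂ A) ℂ)

instance : ContinuousLinearMapClass (Bidual A) ℂ (StrongDual ℂ A) ℂ :=
  inferInstanceAs (ContinuousLinearMapClass (StrongDual ℂ (StrongDual ℂ A)) ℂ (StrongDual ℂ A) ℂ)

theorem Bidual.add_apply (x y : Bidual A) (φ : StrongDual ℂ A) : (x + y) φ = x φ + y φ := rfl

theorem Bidual.sub_apply (x y : Bidual A) (φ : StrongDual ℂ A) : (x - y) φ = x φ - y φ := rfl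

theorem Bidual.smul_apply (c : ℂ) (x : Bidual A) (φ : StrongDual ℂ A) :
    (c • x) φ = c * x φ := rfl

theorem Bidual.real_smul_apply (t : ℝ) (x : Bidual A) (φ : StrongDual ℂ A) :
    (t • x) φ = t * x φ := rfl

theorem Bidual.le_opNorm (x : Bidual A) (φ : StrongDual ℂ A) : ‖x φ‖ ≤ ‖x‖ * ‖φ‖ :=
  ContinuousLinearMap.le_opNorm (σ₁₂ := RingHom.id ℂ) (E := StrongDual ℂ A) (F := ℂ) x φ

end Bidual

section Arens

variable {A : Type*} [NonUnitalCStarAlgebra A]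

/-- The canonical embedding of `A` in its bidual. -/
noncomputable def toBidual : A →L[ℂ] Bidual A :=
  (NormedSpace.inclusionInDoubleDual ℂ A : A →L[ℂ] StrongDual ℂ (StrongDual ℂ A))

theorem toBidual_apply (a : A) (φ : StrongDual ℂ A) : toBidual a φ = φ a := rfl

/-- The left action of the bidual on the dual: `(G • φ) a = G (b ↦ φ (a * b))`. -/
noncomputable def bidualAct (G : Bidual A) : StrongDual ℂ A →L[ℂ] StrongDual ℂ A :=
  (ContinuousLinearMap.compL ℂ A (StrongDual ℂ A) ℂ G).comp
    (((ContinuousLinearMap.compL ℂ A (A →L[ℂ] A) (StrongDual ℂ A)).flip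
      (ContinuousLinearMap.mul ℂ A)).comp (ContinuousLinearMap.compL ℂ A A ℂ))

theorem bidualAct_apply (G : Bidual A) (φ : StrongDual ℂ A) (a : A) :
    bidualAct G φ a = G (φ.comp (ContinuousLinearMap.mul ℂ A a)) := rfl

/-- The (first) Arens product on the bidual: `(F □ G) φ = F (a ↦ G (b ↦ φ (a * b)))`.
For a C*-algebra this is the product of the enveloping von Neumann algebra `A**`. -/
noncomputable def arens (F G : Bidual A) : Bidual A :=
  ContinuousLinearMap.comp (show StrongDual ℂ (StrongDual ℂ A) from F) (bidualAct G)

theorem arens_apply (F G : Bidual A) (φ : StrongDual ℂ A) :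
    arens F G φ = F (bidualAct G φ) := rfl

theorem arens_toBidual (a b : A) :
    arens (toBidual a) (toBidual b) = toBidual (a * b) := rfl

end Arens

/-! ## Weak* limits of bounded monotone nets in the bidual -/

section Limits

variable {B : Type*} [NonUnitalCStarAlgebra B]

attribute [local instance] CStarAlgebra.spectralOrder
attribute [local instance] CStarAlgebra.spectralOrderedRing

theorem sum_norm_apply_le (φ : StrongDual ℂ B) (n : ℕ) (g : ℕ → B)
    (hg : ∀ i, 0 ≤ g i) (hG : ‖∑ i ∈ Finset.range n, g i‖ ≤ 1) :
    ∑ i ∈ Finset.range n, ‖φ (g i)‖ ≤ 4 * ‖φ‖ := by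
  have hsub : ∀ T ⊆ Finset.range n, ‖∑ i ∈ T, φ (g i)‖ ≤ ‖φ‖ := by
    intro T hT
    have h1 : ‖∑ i ∈ T, g i‖ ≤ 1 :=
      (CStarAlgebra.norm_le_norm_of_nonneg_of_le (Finset.sum_nonneg fun i _ => hg i)
        (Finset.sum_le_sum_of_subset_of_nonneg hT fun i _ _ => hg i)).trans hG
    rw [← map_sum]
    calc ‖φ (∑ i ∈ T, g i)‖ ≤ ‖φ‖ * ‖∑ i ∈ T, g i‖ := φ.le_opNorm _
      _ ≤ ‖φ‖ * 1 := by gcongr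
      _ = ‖φ‖ := mul_one _
  have key : ∀ p : ℂ →ₗ[ℝ] ℝ, (∀ z, |p z| ≤ ‖z‖) →
      ∑ i ∈ Finset.range n, |p (φ (g i))| ≤ 2 * ‖φ‖ := by
    intro p hp
    rw [← Finset.sum_filter_add_sum_filter_not (Finset.range n) (fun i => 0 ≤ p (φ (g i)))]
    have e1 : ∑ i ∈ (Finset.range n).filter (fun i => 0 ≤ p (φ (g i))), |p (φ (g i))| ≤ ‖φ‖ := by
      rw [Finset.sum_congr rfl (fun i hi => abs_of_nonneg (Finset.mem_filter.1 hi).2), ← map_sum]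
      exact (le_abs_self _).trans ((hp _).trans (hsub _ (Finset.filter_subset _ _)))
    have e2 : ∑ i ∈ (Finset.range n).filter (fun i => ¬ 0 ≤ p (φ (g i))), |p (φ (g i))|
        ≤ ‖φ‖ := by
      rw [Finset.sum_congr rfl
        (fun i hi => abs_of_neg (not_le.1 (Finset.mem_filter.1 hi).2)),
        Finset.sum_neg_distrib, ← map_sum]
      exact (neg_le_abs _).trans ((hp _).trans (hsub _ (Finset.filter_subset _ _)))
    linarith
  have hre := key Complex.reLm Complex.abs_re_le_norm
  have him := key Complex.imLm Complex.abs_im_le_norm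
  calc ∑ i ∈ Finset.range n, ‖φ (g i)‖
      ≤ ∑ i ∈ Finset.range n, (|Complex.reLm (φ (g i))| + |Complex.imLm (φ (g i))|) :=
        Finset.sum_le_sum fun i _ => Complex.norm_le_abs_re_add_abs_im _
    _ ≤ 4 * ‖φ‖ := by rw [Finset.sum_add_distrib]; linarith

theorem norm_sub_le_one {x y : B} (hx : 0 ≤ x) (hxy : x ≤ y) (hy : ‖y‖ ≤ 1) : ‖y - x‖ ≤ 1 :=
  (CStarAlgebra.norm_le_norm_of_nonneg_of_le (sub_nonneg.2 hxy) (sub_le_self y hx)).trans hy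

theorem exists_small_oscillation {I : Type*} [Preorder I] [Nonempty I] (u : I → B)
    (hu : Monotone u ∨ Antitone u) (h0 : ∀ i, 0 ≤ u i) (h1 : ∀ i, ‖u i‖ ≤ 1)
    (φ : StrongDual ℂ B) {ε : ℝ} (hε : 0 < ε) :
    ∃ i, ∀ j, i ≤ j → ‖φ (u j) - φ (u i)‖ ≤ ε := by
  by_contra! hcon
  choose nxt hle hgt using hcon
  let s : ℕ → I := fun n => nxt^[n] (Classical.arbitrary I)
  have hs : ∀ n, s (n + 1) = nxt (s n) := fun n => Function.iterate_succ_apply' _ _ _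
  have hsm : Monotone s := monotone_nat_of_le_succ fun n => by rw [hs]; exact hle _
  have hbound : ∀ n : ℕ, n * ε ≤ 4 * ‖φ‖ := by
    intro n
    have hlow : n * ε ≤ ∑ i ∈ Finset.range n, ‖φ (u (s (i + 1)) - u (s i))‖ := by
      calc (n : ℝ) * ε = ∑ _i ∈ Finset.range n, ε := by simp
        _ ≤ _ := Finset.sum_le_sum fun i _ => by rw [hs, map_sub]; exact (hgt _).le
    refine hlow.trans ?_
    rcases hu with hu | hu
    · refine sum_norm_apply_le φ n _ (fun i => sub_nonneg.2 (hu (hsm i.le_succ))) ?_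
      rw [Finset.sum_range_sub (fun i => u (s i))]
      exact norm_sub_le_one (h0 _) (hu (hsm n.zero_le)) (h1 _)
    · have : ∀ i, ‖φ (u (s (i + 1)) - u (s i))‖ = ‖φ (u (s i) - u (s (i + 1)))‖ := fun i => by
        rw [map_sub, map_sub, norm_sub_rev]
      simp_rw [this]
      refine sum_norm_apply_le φ n _ (fun i => sub_nonneg.2 (hu (hsm i.le_succ))) ?_
      rw [Finset.sum_range_sub' (fun i => u (s i))]
      exact norm_sub_le_one (h0 _) (hu (hsm n.zero_le)) (h1 _)
  obtain ⟨n, hn⟩ := exists_nat_gt (4 * ‖φ‖ / ε)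
  rw [div_lt_iff₀ hε] at hn
  exact absurd (hbound n) (not_le.2 hn)

/-- A monotone net in the positive part of the unit ball converges weak* in the bidual. -/
theorem exists_bidual_limit {I : Type*} [Preorder I] [Nonempty I] [IsDirectedOrder I] (u : I → B)
    (hu : Monotone u ∨ Antitone u) (h0 : ∀ i, 0 ≤ u i) (h1 : ∀ i, ‖u i‖ ≤ 1) :
    ∃ X : Bidual B, ∀ φ : StrongDual ℂ B, Tendsto (fun i => φ (u i)) atTop (𝓝 (X φ)) := by
  have hlim : ∀ φ : StrongDual ℂ B, ∃ z, Tendsto (fun i => φ (u i)) atTop (𝓝 z) := by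
    intro φ
    refine cauchy_map_iff_exists_tendsto.1 (Metric.cauchy_iff.2 ⟨inferInstance, fun ε hε => ?_⟩)
    obtain ⟨i, hi⟩ := exists_small_oscillation u hu h0 h1 φ (show 0 < ε / 3 by positivity)
    refine ⟨_, image_mem_map (Ici_mem_atTop i), ?_⟩
    rintro _ ⟨j, hj, rfl⟩ _ ⟨k, hk, rfl⟩
    have := dist_triangle_right (φ (u j)) (φ (u k)) (φ (u i))
    have e1 := hi j hj
    have e2 := hi k hk
    rw [← dist_eq_norm] at e1 e2
    change dist (φ (u j)) (φ (u k)) < ε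
    linarith
  choose X hX using hlim
  let L : StrongDual ℂ B →ₗ[ℂ] ℂ :=
    { toFun := X
      map_add' := fun φ ψ => tendsto_nhds_unique (hX (φ + ψ)) ((hX φ).add (hX ψ))
      map_smul' := fun c φ => tendsto_nhds_unique (hX (c • φ)) ((hX φ).const_smul c) }
  refine ⟨(L.mkContinuous 1 fun φ => ?_ : StrongDual ℂ (StrongDual ℂ B)), hX⟩
  refine le_of_tendsto (hX φ).norm (Eventually.of_forall fun i => ?_)
  calc ‖φ (u i)‖ ≤ ‖φ‖ * ‖u i‖ := φ.le_opNorm _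
    _ ≤ ‖φ‖ * 1 := by gcongr; exact h1 i
    _ = 1 * ‖φ‖ := by ring

end Limits

/-! ## The unit of the bidual and the unitization -/

section Unit

variable (A : Type*) [NonUnitalCStarAlgebra A]

attribute [local instance] CStarAlgebra.spectralOrder
attribute [local instance] CStarAlgebra.spectralOrderedRing

theorem exists_bidualOne : ∃ X : Bidual A, ∀ φ : StrongDual ℂ A,
    Tendsto (fun e : {e : A // 0 ≤ e ∧ ‖e‖ < 1} => φ (e : A)) atTop (𝓝 (X φ)) := by
  have : Nonempty {e : A // 0 ≤ e ∧ ‖e‖ < 1} := ⟨⟨0, le_rfl, by simp⟩⟩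
  have : IsDirectedOrder {e : A // 0 ≤ e ∧ ‖e‖ < 1} := ⟨by
    rintro ⟨x, hx⟩ ⟨y, hy⟩
    obtain ⟨z, hz, hxz, hyz⟩ := CStarAlgebra.directedOn_nonneg_ball (A := A) x (by simpa using hx)
      y (by simpa using hy)
    exact ⟨⟨z, by simpa using hz⟩, hxz, hyz⟩⟩
  exact exists_bidual_limit _ (Or.inl fun _ _ h => h) (fun e => e.2.1) (fun e => e.2.2.le)

/-- The unit of `A**`: the weak* limit of the canonical increasing approximate unit of `A`,
i.e. of the positive elements of norm less than `1`, directed by the order of `A`. -/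
noncomputable def bidualOne : Bidual A := (exists_bidualOne A).choose

theorem tendsto_bidualOne (φ : StrongDual ℂ A) :
    Tendsto (fun e : {e : A // 0 ≤ e ∧ ‖e‖ < 1} => φ (e : A)) atTop (𝓝 (bidualOne A φ)) :=
  (exists_bidualOne A).choose_spec φ

/-- The self-adjoint part of the smallest unital C*-algebra containing `A`. This C*-algebra is
realized, with its norm, as `A + ℂ 1` inside `A**`; it is `A` when `A` is unital and the standard
unitization otherwise. Its self-adjoint elements are the `a + t 1` with `a` self-adjoint in `A`
and `t` real. -/
noncomputable def saUnitization : Submodule ℝ (Bidual A) where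
  carrier := {x | ∃ a : A, IsSelfAdjoint a ∧ ∃ t : ℝ, x = toBidual a + t • bidualOne A}
  zero_mem' := ⟨0, IsSelfAdjoint.zero A, 0, by simp⟩
  add_mem' := by
    rintro _ _ ⟨a, ha, s, rfl⟩ ⟨b, hb, t, rfl⟩
    exact ⟨a + b, ha.add hb, s + t, by rw [map_add, add_smul]; abel⟩
  smul_mem' := by
    rintro c _ ⟨a, ha, s, rfl⟩
    refine ⟨c • a, (IsSelfAdjoint.all c).smul ha, c * s, ?_⟩
    rw [smul_add, mul_smul, ← Complex.coe_smul c a, map_smul, Complex.coe_smul]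

end Unit

/-! ## Indicator functions of compact subsets of the spectrum of an Abelian C*-algebra -/

section Indicator

variable {B : Type*} [NonUnitalCommCStarAlgebra B]

attribute [local instance] CStarAlgebra.spectralOrder
attribute [local instance] CStarAlgebra.spectralOrderedRing

/-- The elements `f` of `B` with `1_K ≤ f ≤ 1`, as functions on the spectrum of `B`. -/
abbrev Majorant (K : TopologicalSpace.Compacts (WeakDual.characterSpace ℂ B)) : Type _ :=
  {f : B // 0 ≤ f ∧ ‖f‖ ≤ 1 ∧ ∀ x ∈ K, x f = 1}

theorem character_star (x : WeakDual.characterSpace ℂ B) (b : B) : x (star b) = star (x b) := by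
  let y : Unitization ℂ B →ₐ[ℂ] ℂ :=
    Unitization.lift (WeakDual.CharacterSpace.toNonUnitalAlgHom x)
  have hy : ∀ b : B, y (b : Unitization ℂ B) = x b := fun b => by
    simp [y]
  rw [← hy, ← hy, Unitization.inr_star]
  exact map_star y _

theorem mul_le_of_comm {f g : B} (hf : 0 ≤ f)
    (hg : 0 ≤ g) (hg1 : ‖g‖ ≤ 1) : 0 ≤ f * g ∧ f * g ≤ f := by
  have hs : CFC.sqrt f * CFC.sqrt f = f := CFC.sqrt_mul_sqrt_self f
  have hsa : star (CFC.sqrt f) = CFC.sqrt f := (CFC.sqrt_nonneg f).isSelfAdjoint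
  have e : f * g = star (CFC.sqrt f) * g * CFC.sqrt f := by
    rw [hsa, mul_right_comm, hs]
  refine ⟨e ▸ star_left_conjugate_nonneg hg _, ?_⟩
  have h := CStarAlgebra.star_left_conjugate_le_norm_smul (a := CFC.sqrt f) (b := g)
  rw [← e, hsa, hs] at h
  refine h.trans ?_
  have := smul_le_smul_of_nonneg_right hg1 hf
  rwa [one_smul] at this

theorem exists_majorant (K : TopologicalSpace.Compacts (WeakDual.characterSpace ℂ B)) :
    ∃ f : B, 0 ≤ f ∧ ‖f‖ ≤ 1 ∧ ∀ x ∈ K, x f = 1 := by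
  have hsq : ∀ (x : WeakDual.characterSpace ℂ B) (m : B),
      x (star m * m) = ((‖x m‖ ^ 2 : ℝ) : ℂ) := fun x m => by
    rw [map_mul, character_star]
    simpa using Complex.conj_mul' (x m)
  have hcont : ∀ m : B, Continuous fun x : WeakDual.characterSpace ℂ B => x m := fun m =>
    (WeakDual.eval_continuous m).comp continuous_subtype_val
  obtain ⟨t, ht⟩ := K.isCompact.elim_finite_subcover
    (fun m : B => {x : WeakDual.characterSpace ℂ B | 0 < ‖x m‖ ^ 2})
    (fun m => isOpen_lt continuous_const ((hcont m).norm.pow 2)) (by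
      intro x _
      obtain ⟨m, hm⟩ : ∃ m, x m ≠ 0 := by
        by_contra! h
        exact x.2.1 (DFunLike.ext _ _ h)
      exact Set.mem_iUnion.2 ⟨m, pow_pos (norm_pos_iff.2 hm) 2⟩)
  set g : B := ∑ m ∈ t, star m * m with hg
  have hg0 : 0 ≤ g := Finset.sum_nonneg fun m _ => star_mul_self_nonneg m
  have hxg : ∀ x : WeakDual.characterSpace ℂ B, x g = ((∑ m ∈ t, ‖x m‖ ^ 2 : ℝ) : ℂ) := by
    intro x
    rw [hg, map_sum, Complex.ofReal_sum]
    exact Finset.sum_congr rfl fun m _ => hsq x m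
  obtain ⟨δ, hδ, hKδ⟩ : ∃ δ : ℝ, 0 < δ ∧ ∀ x ∈ K, δ ≤ ∑ m ∈ t, ‖x m‖ ^ 2 := by
    rcases (K : Set (WeakDual.characterSpace ℂ B)).eq_empty_or_nonempty with h | h
    · exact ⟨1, one_pos, fun x hx => by
        have : x ∈ (K : Set (WeakDual.characterSpace ℂ B)) := hx
        simp [h] at this⟩
    · have hF : Continuous fun x : WeakDual.characterSpace ℂ B => ∑ m ∈ t, ‖x m‖ ^ 2 :=
        continuous_finsetSum t fun m _ => (hcont m).norm.pow 2
      obtain ⟨x₀, hx₀, hmin⟩ := K.isCompact.exists_isMinOn h hF.continuousOn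
      have hpos : 0 < ∑ m ∈ t, ‖x₀ m‖ ^ 2 := by
        obtain ⟨m, hm⟩ := Set.mem_iUnion.1 (ht hx₀)
        obtain ⟨hmt, hm⟩ := Set.mem_iUnion.1 hm
        exact Finset.sum_pos' (fun i _ => sq_nonneg _) ⟨m, hmt, hm⟩
      exact ⟨_, hpos, fun x hx => isMinOn_iff.1 hmin x hx⟩
  let p : ℝ → ℝ := fun r => max 0 (min (r / δ) 1)
  have hpc : Continuous p := by fun_prop
  have hp0 : p 0 = 0 := by simp [p]
  have hp01 : ∀ r, 0 ≤ p r ∧ p r ≤ 1 := fun r => by simp [p]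
  refine ⟨cfcₙ p g, cfcₙ_nonneg fun r _ => (hp01 r).1, ?_, ?_⟩
  · refine norm_cfcₙ_le fun r _ => ?_
    rw [Real.norm_of_nonneg (hp01 r).1]
    exact (hp01 r).2
  · intro x hx
    let y : B →⋆ₙₐ[ℂ] ℂ :=
      { WeakDual.CharacterSpace.toNonUnitalAlgHom x with map_star' := character_star x }
    have hyx : ∀ b, y b = x b := fun _ => rfl
    have hsa : IsSelfAdjoint g := hg0.isSelfAdjoint
    have hyc : Continuous y := (WeakDual.CharacterSpace.toCLM x).continuous
    have h1 : y (cfcₙ p g) = cfcₙ p (y g) :=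
      NonUnitalStarAlgHomClass.map_cfcₙ y p g (hpc.continuousOn) hp0 hyc hsa (hsa.map y)
    rw [← hyx, h1, hyx, hxg, cfcₙ_eq_cfc (hpc.continuousOn) hp0]
    have h2 := cfc_algebraMap (A := ℂ) (∑ m ∈ t, ‖x m‖ ^ 2) p
    have h3 : p (∑ m ∈ t, ‖x m‖ ^ 2) = 1 := by
      have : 1 ≤ (∑ m ∈ t, ‖x m‖ ^ 2) / δ := (one_le_div hδ).2 (hKδ x hx)
      simp [p, this]
    rw [h3] at h2
    simpa using h2

instance (K : TopologicalSpace.Compacts (WeakDual.characterSpace ℂ B)) :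
    Nonempty (Majorant K) :=
  let ⟨f, hf⟩ := exists_majorant K
  ⟨⟨f, hf⟩⟩

theorem exists_indicator (K : TopologicalSpace.Compacts (WeakDual.characterSpace ℂ B)) :
    ∃ X : Bidual B, ∀ ψ : StrongDual ℂ B,
      Tendsto (fun f : Majorant K => ψ (f : B)) atBot (𝓝 (X ψ)) := by
  have : IsDirectedOrder (Majorant K)ᵒᵈ := ⟨by
    rintro ⟨f, hf⟩ ⟨g, hg⟩
    have h1 := mul_le_of_comm hf.1 hg.1 hg.2.1
    have h2 := mul_le_of_comm hg.1 hf.1 hf.2.1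
    rw [mul_comm] at h2
    refine ⟨OrderDual.toDual ⟨f * g, h1.1, ?_, fun x hx => ?_⟩, h1.2, h2.2⟩
    · exact (norm_mul_le f g).trans (mul_le_one₀ hf.2.1 (norm_nonneg _) hg.2.1)
    · rw [map_mul, hf.2.2 x hx, hg.2.2 x hx, one_mul]⟩
  exact exists_bidual_limit (I := (Majorant K)ᵒᵈ)
    (fun f => ((OrderDual.ofDual f : Majorant K) : B))
    (Or.inr fun _ _ h => h) (fun f => (OrderDual.ofDual f).2.1)
    (fun f => (OrderDual.ofDual f).2.2.1)

/-- The indicator function of a compact subset `K` of the spectrum of `B`, as an element of `B**`: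
its value at `ψ` is the mass `ψ(K)` of the Radon measure representing `ψ`, that is, the limit of
`ψ f` as `f` decreases to `1_K` among the elements of `B` with `1_K ≤ f ≤ 1`. -/
noncomputable def compactIndicator
    (K : TopologicalSpace.Compacts (WeakDual.characterSpace ℂ B)) : Bidual B :=
  (exists_indicator K).choose

theorem tendsto_compactIndicator
    (K : TopologicalSpace.Compacts (WeakDual.characterSpace ℂ B)) (ψ : StrongDual ℂ B) :
    Tendsto (fun f : Majorant K => ψ (f : B)) atBot (𝓝 (compactIndicator K ψ)) :=
  (exists_indicator K).choose_spec ψ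

end Indicator

/-! ## States, Lipschitz pairs, topographic quantum spaces, Lipschitz triples -/

/-- The state space of `A`: the positive linear functionals of norm `1`. The value of (the normal
extension of) a state `φ` at `x : Bidual A` is `x φ`; in particular this gives the value of `φ` on
the unitization. -/
def stateSpace (A : Type*) [NonUnitalCStarAlgebra A] : Set (StrongDual ℂ A) :=
  {φ | (∀ a : A, 0 ≤ φ (star a * a)) ∧ ‖φ‖ = 1}

/-- A Lipschitz pair `(A, L)`: a seminorm `L` on a dense subspace of the self-adjoint part of the
unitization of `A`, whose kernel is `ℝ 1`. -/
structure LipschitzPair (A : Type*) [NonUnitalCStarAlgebra A] where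
  /-- The domain of the seminorm. -/
  dom : Submodule ℝ (saUnitization A)
  dense_dom : Dense (dom : Set (saUnitization A))
  /-- The seminorm. -/
  L : Seminorm ℝ dom
  ker_eq : ∀ x : saUnitization A,
    (∃ h : x ∈ dom, L ⟨x, h⟩ = 0) ↔ ∃ t : ℝ, (x : Bidual A) = t • bidualOne A

/-- A topographic quantum space `(A, M)`: an Abelian C*-subalgebra `M` of `A` which contains an
approximate identity for `A`. -/
structure Topography (A : Type*) [NonUnitalCStarAlgebra A] where
  /-- The Abelian C*-subalgebra. -/
  M : NonUnitalStarSubalgebra ℂ A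
  isClosed_M : IsClosed (M : Set A)
  comm_M : ∀ x ∈ M, ∀ y ∈ M, x * y = y * x
  exists_approximateUnit : ∃ l : Filter A, (M : Set A) ∈ l ∧ l.IsApproximateUnit

/-- A Lipschitz triple `(A, L, M)`. -/
structure LipschitzTriple (A : Type*) [NonUnitalCStarAlgebra A] extends
  LipschitzPair A, Topography A

section Topography

variable {A : Type*} [NonUnitalCStarAlgebra A]

noncomputable instance (T : Topography A) : NonUnitalCommCStarAlgebra T.M where
  toNonUnitalCStarAlgebra :=
    NonUnitalStarSubalgebra.nonUnitalCStarAlgebra T.M (h_closed := T.isClosed_M)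
  mul_comm x y := Subtype.ext (T.comm_M x x.2 y y.2)

/-- The Gelfand spectrum of the topography, with the weak* topology. -/
abbrev Topography.spectrum (T : Topography A) : Type _ := WeakDual.characterSpace ℂ T.M

/-- The inclusion of `M` in `A`. -/
def Topography.inclusion (T : Topography A) : T.M →L[ℂ] A where
  toFun m := m
  map_add' _ _ := rfl
  map_smul' _ _ := rfl
  cont := continuous_subtype_val

/-- The inclusion of `M**` in `A**`: the second adjoint of the inclusion of `M` in `A`. -/
noncomputable def Topography.bidualInclusion (T : Topography A) (X : Bidual T.M) : Bidual A :=
  ContinuousLinearMap.comp (show StrongDual ℂ (StrongDual ℂ T.M) from X)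
    ((ContinuousLinearMap.compL ℂ T.M A ℂ).flip T.inclusion)

theorem Topography.bidualInclusion_apply (T : Topography A) (X : Bidual T.M)
    (φ : StrongDual ℂ A) : T.bidualInclusion X φ = X (φ.comp T.inclusion) := rfl

/-- The indicator function `1_K` of a compact subset `K` of the spectrum of `M`, in `A**`. -/
noncomputable def Topography.indicator (T : Topography A)
    (K : TopologicalSpace.Compacts T.spectrum) : Bidual A :=
  T.bidualInclusion (compactIndicator K)

/-- The compression `1_K x 1_K`, in `A**`. -/
noncomputable def Topography.compress (T : Topography A)
    (K : TopologicalSpace.Compacts T.spectrum) (x : Bidual A) : Bidual A :=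
  arens (arens (T.indicator K) x) (T.indicator K)

/-! ### Tight sets, local states, tame sets -/

/-- A set `𝒦` of states is tight when for all `ε > 0` there is a compact `Q` such that
`sup {φ (1 - 1_K) : φ ∈ 𝒦} < ε` for every compact `K ⊇ Q`. (The numbers `φ (1 - 1_K)` are
nonnegative; the supremum is taken in `[0, ∞]`.) -/
def Topography.IsTight (T : Topography A) (𝒦 : Set (StrongDual ℂ A)) : Prop :=
  ∀ ε : ℝ≥0∞, 0 < ε → ∃ Q : TopologicalSpace.Compacts T.spectrum,
    ∀ K : TopologicalSpace.Compacts T.spectrum, Q ≤ K →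
      ⨆ φ ∈ 𝒦, ‖(bidualOne A - T.indicator K) φ‖ₑ < ε

/-- The local states: the states `φ` with `φ (1_K) = 1` for some compact `K`. -/
def Topography.localStates (T : Topography A) : Set (StrongDual ℂ A) :=
  {φ | φ ∈ stateSpace A ∧ ∃ K : TopologicalSpace.Compacts T.spectrum, T.indicator K φ = 1}

/-- The self-adjoint elements `a` of the unitization of `A` with `L a ≤ 1` and `μ a = 0`. -/
def LipschitzPair.lipBall (P : LipschitzPair A) (μ : StrongDual ℂ A) : Set (Bidual A) :=
  {a | ∃ x : P.dom, (((x : saUnitization A) : Bidual A) = a) ∧ P.L x ≤ 1 ∧ a μ = 0}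

/-- A set `𝒦` of states is tame when for some local state `μ` the supremum of
`|φ (a - 1_K a 1_K)|` over `φ ∈ 𝒦` and `a` in `lipBall μ` tends to `0` along the compact sets `K`,
directed by inclusion. -/
def LipschitzTriple.IsTame (T : LipschitzTriple A) (𝒦 : Set (StrongDual ℂ A)) : Prop :=
  ∃ μ ∈ T.localStates, Tendsto
    (fun K : TopologicalSpace.Compacts T.spectrum =>
      ⨆ a ∈ T.lipBall μ, ⨆ φ ∈ 𝒦, ‖(a - T.compress K a) φ‖ₑ) atTop (𝓝 0)

end Topography

end QuantumMetric

namespace QuantumMetric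

/-! ### Characters of an Abelian C*-algebra and majorants of compact sets -/

section Commutative

variable {B : Type*} [NonUnitalCommCStarAlgebra B]

attribute [local instance] CStarAlgebra.spectralOrder
attribute [local instance] CStarAlgebra.spectralOrderedRing

/-! Tameness is tested on a single element. Let `μ` be the local state, carried by a compact `K₀`,
and choose `f` in `M` with `1_{K₀} ≤ f ≤ 1` and compact support (`exists_majorant_forall_mul_eq`).
Then `μ f = 1`, so `1 - f` vanishes at `μ`. Once `K` contains the support of `f`, one has `1_K f 1_K
= f` and `1_K 1 1_K = 1_K` (`Topography.compress_toBidual_apply`,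
`Topography.compress_bidualOne_apply`), hence `(1 - f) - 1_K (1 - f) 1_K = 1 - 1_K`, and smallness
of the left side on `𝒦` is exactly tightness. The element `1 - f` need not lie in the domain of `L`,
but that domain is dense and contains `1`, so `1 - f` is a norm limit of elements of the domain
vanishing at `μ`. States and compressions are contractive, so the approximation costs little, and
rescaling brings each approximant into the Lipschitz ball.

For the weak* closure, positivity and norm at most `1` always survive; only mass can be lost.
Tightness gives one `f` in `M` with `‖f‖ ≤ 1` and `ψ f` at least `1 - ε` in real part for every `ψ`
in `𝒦`. This inequality is weak* closed, so limits still have norm `1`. -/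

theorem character_cfcₙ (x : WeakDual.characterSpace ℂ B) {p : ℝ → ℝ} (hp : Continuous p)
    (hp0 : p 0 = 0) {g : B} (hg : IsSelfAdjoint g) : x (cfcₙ p g) = p (x g).re := by
  let y : B →⋆ₙₐ[ℂ] ℂ :=
    { WeakDual.CharacterSpace.toNonUnitalAlgHom x with map_star' := character_star x }
  have hyx : ∀ b, y b = x b := fun _ => rfl
  have hyc : Continuous y := (WeakDual.CharacterSpace.toCLM x).continuous
  have h1 : y (cfcₙ p g) = cfcₙ p (y g) :=
    NonUnitalStarAlgHomClass.map_cfcₙ y p g hp.continuousOn hp0 hyc hg (hg.map y)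
  have hre : y g = algebraMap ℝ ℂ (x g).re := (Complex.conj_eq_iff_re.1 (hg.map y)).symm
  rw [← hyx, h1, hre, cfcₙ_eq_cfc hp.continuousOn hp0, cfc_algebraMap]
  rfl

/-- A character extends to a unital character of the unitization, where it is contractive, and the
embedding into the unitization is isometric. -/
theorem norm_character_apply_le (x : WeakDual.characterSpace ℂ B) (b : B) : ‖x b‖ ≤ ‖b‖ := by
  let y : Unitization ℂ B →ₐ[ℂ] ℂ :=
    Unitization.lift (WeakDual.CharacterSpace.toNonUnitalAlgHom x)
  have hy : y (b : Unitization ℂ B) = x b := by simp [y]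
  rw [← hy, ← Unitization.norm_inr (𝕜 := ℂ) b]
  exact AlgHom.norm_apply_le_self y _

/-- The Gelfand transform of the unitization is injective, and a character of the unitization
restricts to `B` either as `0` or as a character of `B`. -/
theorem eq_zero_of_forall_character {b : B}
    (h : ∀ x : WeakDual.characterSpace ℂ B, x b = 0) : b = 0 := by
  have hinj := (gelfandTransform_isometry (Unitization ℂ B)).injective
  have h0 : (b : Unitization ℂ B) = 0 := by
    refine hinj (ContinuousMap.ext fun y => ?_)
    rw [map_zero]
    change y (b : Unitization ℂ B) = 0
    let z : StrongDual ℂ B :=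
      { toFun := fun c => y (c : Unitization ℂ B)
        map_add' := fun c d => by rw [Unitization.inr_add, map_add]
        map_smul' := fun r c => by rw [Unitization.inr_smul, map_smul]; rfl
        cont := (map_continuous y).comp
          (Unitization.isometry_inr (𝕜 := ℂ) (A := B)).continuous }
    by_cases hz : z = 0
    · exact DFunLike.congr_fun hz b
    · exact h ⟨StrongDual.toWeakDual z, hz, fun c d => by
        change y ((c * d : B) : Unitization ℂ B) = y c * y d
        rw [Unitization.inr_mul, map_mul]⟩
  exact Unitization.inr_injective (h0.trans (Unitization.inr_zero ℂ).symm)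

/-- Adding the zero functional, the point at infinity, makes the spectrum weak* closed in the unit
ball. The condition `r ≤ ‖x b‖` with `r > 0` is closed and excludes that point. -/
theorem isCompact_setOf_le_norm_character (b : B) {r : ℝ} (hr : 0 < r) :
    IsCompact {x : WeakDual.characterSpace ℂ B | r ≤ ‖x b‖} := by
  rw [Subtype.isCompact_iff]
  have himage : ((↑) '' {x : WeakDual.characterSpace ℂ B | r ≤ ‖x b‖} : Set (WeakDual ℂ B)) =
      (WeakDual.characterSpace ℂ B ∪ {0}) ∩ {φ : WeakDual ℂ B | r ≤ ‖φ b‖} := by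
    ext φ
    constructor
    · rintro ⟨x, hx, rfl⟩
      exact ⟨Or.inl x.2, hx⟩
    · rintro ⟨hφ | hφ, hb⟩
      · exact ⟨⟨φ, hφ⟩, hb, rfl⟩
      · rw [Set.mem_singleton_iff.1 hφ] at hb
        have : r ≤ ‖(0 : ℂ)‖ := hb
        rw [norm_zero] at this
        exact absurd this (not_le.2 hr)
  rw [himage]
  refine (WeakDual.isCompact_closedBall (0 : StrongDual ℂ B) 1).of_isClosed_subset
    ((WeakDual.CharacterSpace.union_zero_isClosed ℂ B).inter
      (isClosed_le continuous_const (WeakDual.eval_continuous b).norm)) ?_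
  rw [← himage]
  rintro _ ⟨x, -, rfl⟩
  refine mem_closedBall_zero_iff.2 (ContinuousLinearMap.opNorm_le_bound _ zero_le_one fun c => ?_)
  rw [one_mul]
  exact norm_character_apply_le x c

/-- Every compact set in the spectrum has a majorant with compact support. -/
theorem exists_majorant_forall_mul_eq
    (K : TopologicalSpace.Compacts (WeakDual.characterSpace ℂ B)) :
    ∃ (f : Majorant K) (K' : TopologicalSpace.Compacts (WeakDual.characterSpace ℂ B)),
      ∀ g : B, (∀ x ∈ K', x g = 1) → g * f = f := by
  obtain ⟨f, hf0, -, hfK⟩ := exists_majorant K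
  -- This ramp is `0` up to `1/2` and equals `1` at `1`, so `p(f)` is still `1` on `K` but vanishes
  -- off the compact set where `‖x f‖ ≥ 1/2`, which serves as `K'`.
  let p : ℝ → ℝ := fun r => max 0 (min (2 * r - 1) 1)
  have hpc : Continuous p := by fun_prop
  have hp0 : p 0 = 0 := by simp [p]
  have hp01 : ∀ r, 0 ≤ p r ∧ p r ≤ 1 := fun r => by simp [p]
  have hx : ∀ x : WeakDual.characterSpace ℂ B, x (cfcₙ p f) = p (x f).re := fun x =>
    character_cfcₙ x hpc hp0 hf0.isSelfAdjoint
  refine ⟨⟨cfcₙ p f, cfcₙ_nonneg fun r _ => (hp01 r).1, norm_cfcₙ_le fun r _ => ?_, ?_⟩,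
    ⟨_, isCompact_setOf_le_norm_character f (one_half_pos (α := ℝ))⟩, fun g hg => ?_⟩
  · rw [Real.norm_of_nonneg (hp01 r).1]
    exact (hp01 r).2
  · intro x hxK
    rw [hx, hfK x hxK]
    norm_num [p]
  · refine sub_eq_zero.1 (eq_zero_of_forall_character fun x => ?_)
    rw [map_sub, map_mul, hx]
    by_cases h : 1 / 2 ≤ ‖x f‖
    · rw [hg x h, one_mul, sub_self]
    · have h1 : (x f).re ≤ 1 / 2 := (Complex.re_le_norm _).trans (not_le.1 h).le
      have h2 : p (x f).re = 0 := max_eq_left ((min_le_left _ _).trans (by linarith))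
      rw [h2, Complex.ofReal_zero, mul_zero, sub_zero]

theorem majorant_mul_mem {K : TopologicalSpace.Compacts (WeakDual.characterSpace ℂ B)}
    (f g : Majorant K) :
    0 ≤ (f * g : B) ∧ ‖(f * g : B)‖ ≤ 1 ∧ ∀ x ∈ K, x (f * g : B) = 1 :=
  ⟨(mul_le_of_comm f.2.1 g.2.1 g.2.2.1).1,
    (norm_mul_le _ _).trans (mul_le_one₀ f.2.2.1 (norm_nonneg _) g.2.2.1),
    fun x hx => by rw [map_mul, f.2.2.2 x hx, g.2.2.2 x hx, one_mul]⟩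

theorem majorant_mul_le_left {K : TopologicalSpace.Compacts (WeakDual.characterSpace ℂ B)}
    (f g : Majorant K) : (⟨f * g, majorant_mul_mem f g⟩ : Majorant K) ≤ f :=
  (mul_le_of_comm f.2.1 g.2.1 g.2.2.1).2

theorem majorant_mul_le_right {K : TopologicalSpace.Compacts (WeakDual.characterSpace ℂ B)}
    (f g : Majorant K) : (⟨f * g, majorant_mul_mem f g⟩ : Majorant K) ≤ g := by
  have h := (mul_le_of_comm g.2.1 f.2.1 f.2.2.1).2
  rw [mul_comm] at h
  exact h

/-- Codirectedness makes `atBot` a proper filter, so that limits along majorants are unique. -/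
instance (K : TopologicalSpace.Compacts (WeakDual.characterSpace ℂ B)) :
    IsCodirectedOrder (Majorant K) :=
  ⟨fun f g => ⟨_, majorant_mul_le_left f g, majorant_mul_le_right f g⟩⟩

/-- Multiplying a majorant of `K` by `f` does not change the limit `ψ(K)`. -/
theorem compactIndicator_comp_mul
    {K : TopologicalSpace.Compacts (WeakDual.characterSpace ℂ B)} (f : Majorant K)
    (ψ : StrongDual ℂ B) :
    compactIndicator K (ψ.comp (ContinuousLinearMap.mul ℂ B f)) = compactIndicator K ψ :=
  tendsto_nhds_unique
    (tendsto_compactIndicator K (ψ.comp (ContinuousLinearMap.mul ℂ B f)))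
    ((tendsto_compactIndicator K ψ).comp
      -- The products `f * g` are again majorants and lie below `g`, so they run to the bottom with
      -- `g`.
      (tendsto_atBot_mono (majorant_mul_le_right f) tendsto_id))

end Commutative

/-! ### States: Cauchy–Schwarz and the value at the unit -/

section States

variable {A : Type*} [NonUnitalCStarAlgebra A]

attribute [local instance] CStarAlgebra.spectralOrder
attribute [local instance] CStarAlgebra.spectralOrderedRing

theorem apply_nonneg_of_mem_stateSpace {φ : StrongDual ℂ A} (hφ : φ ∈ stateSpace A) {a : A}
    (ha : 0 ≤ a) : 0 ≤ φ a := by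
  obtain ⟨b, rfl⟩ := CStarAlgebra.nonneg_iff_eq_star_mul_self.1 ha
  exact hφ.1 b

/-- A state as a positive linear map. -/
noncomputable def statePositive {φ : StrongDual ℂ A} (hφ : φ ∈ stateSpace A) : A →ₚ[ℂ] ℂ :=
  PositiveLinearMap.mk₀ φ fun _ ha => apply_nonneg_of_mem_stateSpace hφ ha

theorem apply_star_of_mem_stateSpace {φ : StrongDual ℂ A} (hφ : φ ∈ stateSpace A) (a : A) :
    φ (star a) = star (φ a) :=
  map_star (statePositive hφ) a

theorem mul_self_le_self_of_norm_le_one {e : A} (he : 0 ≤ e) (he1 : ‖e‖ ≤ 1) : e * e ≤ e := by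
  have hs : CFC.sqrt e * CFC.sqrt e = e := CFC.sqrt_mul_sqrt_self e
  have hsa : star (CFC.sqrt e) = CFC.sqrt e := (CFC.sqrt_nonneg e).isSelfAdjoint
  have hconj : CFC.sqrt e * e * CFC.sqrt e = e * e := by
    nth_rw 2 [← hs]
    rw [← mul_assoc, hs, mul_assoc, hs]
  have h := CStarAlgebra.star_left_conjugate_le_norm_smul (a := CFC.sqrt e) (b := e)
  rw [hsa, hconj, hs] at h
  refine h.trans ?_
  have := smul_le_smul_of_nonneg_right he1 he
  rwa [one_smul] at this

/-- Cauchy–Schwarz for the pre-inner product of the GNS construction. -/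
theorem sq_norm_apply_star_mul_le {φ : StrongDual ℂ A} (hφ : φ ∈ stateSpace A) (a b : A) :
    ‖φ (star a * b)‖ ^ 2 ≤ ‖φ (star a * a)‖ * ‖φ (star b * b)‖ := by
  let f := statePositive hφ
  have h : ‖φ (star a * b)‖ ≤ ‖f.toPreGNS a‖ * ‖f.toPreGNS b‖ :=
    norm_inner_le_norm (𝕜 := ℂ) (f.toPreGNS a) (f.toPreGNS b)
  have hsq : ∀ c, ‖f.toPreGNS c‖ ^ 2 = ‖φ (star c * c)‖ := fun c => by
    have h1 := congrArg norm (f.preGNS_norm_sq (f.toPreGNS c))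
    rwa [norm_pow, Complex.norm_real, norm_norm] at h1
  rw [← hsq, ← hsq, ← mul_pow]
  gcongr

instance : Nonempty {e : A // 0 ≤ e ∧ ‖e‖ < 1} := ⟨⟨0, le_rfl, by simp⟩⟩

instance : IsDirectedOrder {e : A // 0 ≤ e ∧ ‖e‖ < 1} := ⟨by
  rintro ⟨x, hx⟩ ⟨y, hy⟩
  obtain ⟨z, hz, hxz, hyz⟩ := CStarAlgebra.directedOn_nonneg_ball (A := A) x (by simpa using hx)
    y (by simpa using hy)
  exact ⟨⟨z, by simpa using hz⟩, hxz, hyz⟩⟩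

theorem tendsto_coe_approximateUnit :
    Tendsto (fun e : {e : A // 0 ≤ e ∧ ‖e‖ < 1} => (e : A)) atTop
      (CStarAlgebra.approximateUnit A) := by
  refine (CStarAlgebra.hasBasis_approximateUnit A).tendsto_right_iff.2 fun x hx => ?_
  filter_upwards [eventually_ge_atTop ⟨x, hx⟩] with e he
  exact ⟨he, mem_closedBall_zero_iff.2 e.2.2.le⟩

theorem bidualOne_comp_mul (φ : StrongDual ℂ A) (a : A) :
    bidualOne A (φ.comp (ContinuousLinearMap.mul ℂ A a)) = φ a :=
  tendsto_nhds_unique (tendsto_bidualOne A (φ.comp (ContinuousLinearMap.mul ℂ A a)))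
    ((φ.continuous.tendsto a).comp
      (((CStarAlgebra.increasingApproximateUnit A).tendsto_mul_left a).comp
        tendsto_coe_approximateUnit))

theorem norm_bidualOne_apply_le (φ : StrongDual ℂ A) : ‖bidualOne A φ‖ ≤ ‖φ‖ :=
  le_of_tendsto (tendsto_bidualOne A φ).norm (Eventually.of_forall fun e =>
    (φ.le_opNorm _).trans (mul_le_of_le_one_right (norm_nonneg _) e.2.2.le))

/-- Cauchy–Schwarz applied to `φ (a * e)`, with `e * e ≤ e`, gives in the limit `‖φ a‖² ≤ ‖a‖²
φ(1)`. Hence `1 = ‖φ‖ ≤ √φ(1)`, while `0 ≤ φ(1) ≤ 1`. -/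
theorem bidualOne_apply_of_mem_stateSpace {φ : StrongDual ℂ A} (hφ : φ ∈ stateSpace A) :
    bidualOne A φ = 1 := by
  have hnonneg : 0 ≤ bidualOne A φ :=
    ge_of_tendsto (tendsto_bidualOne A φ)
      (Eventually.of_forall fun e => apply_nonneg_of_mem_stateSpace hφ e.2.1)
  have hle : ‖bidualOne A φ‖ ≤ 1 := hφ.2 ▸ norm_bidualOne_apply_le φ
  have hbound : ∀ a : A, ‖φ a‖ ^ 2 ≤ ‖a‖ ^ 2 * ‖bidualOne A φ‖ := by
    intro a
    have hlim : Tendsto (fun e : {e : A // 0 ≤ e ∧ ‖e‖ < 1} => ‖φ (a * e)‖ ^ 2) atTop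
        (𝓝 (‖φ a‖ ^ 2)) :=
      (((φ.continuous.tendsto a).comp
        (((CStarAlgebra.increasingApproximateUnit A).tendsto_mul_left a).comp
          tendsto_coe_approximateUnit)).norm).pow 2
    refine le_of_tendsto_of_tendsto hlim ((tendsto_bidualOne A φ).norm.const_mul (‖a‖ ^ 2))
      (Eventually.of_forall fun e => ?_)
    have h1 := sq_norm_apply_star_mul_le hφ (star a) (e : A)
    rw [star_star] at h1
    have h2 : ‖φ (a * star a)‖ ≤ ‖a‖ ^ 2 := by
      refine (φ.le_opNorm _).trans ?_
      rw [hφ.2, one_mul, CStarRing.norm_self_mul_star, sq]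
    have h3 : ‖φ (star (e : A) * e)‖ ≤ ‖φ (e : A)‖ := by
      refine CStarAlgebra.norm_le_norm_of_nonneg_of_le (hφ.1 _) ?_
      rw [← sub_nonneg, ← map_sub]
      refine apply_nonneg_of_mem_stateSpace hφ (sub_nonneg.2 ?_)
      rw [e.2.1.isSelfAdjoint.star_eq]
      exact mul_self_le_self_of_norm_le_one e.2.1 e.2.2.le
    exact h1.trans (mul_le_mul h2 h3 (norm_nonneg _) (sq_nonneg _))
  have h1 : ‖φ‖ ≤ Real.sqrt ‖bidualOne A φ‖ :=
    φ.opNorm_le_bound (Real.sqrt_nonneg _) fun a => by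
      rw [← Real.sqrt_sq (norm_nonneg a), ← Real.sqrt_mul (norm_nonneg _), mul_comm]
      exact Real.le_sqrt_of_sq_le (hbound a)
  rw [hφ.2, Real.one_le_sqrt] at h1
  have h2 := Complex.eq_coe_norm_of_nonneg hnonneg
  rw [h2, le_antisymm hle h1, Complex.ofReal_one]

end States

/-! ### Indicators and compressions in the bidual -/

section Compression

variable {A : Type*} [NonUnitalCStarAlgebra A]

/-- The spectral order of the Abelian subalgebra. -/
noncomputable abbrev Topography.spectralOrder (T : Topography A) : PartialOrder T.M :=
  CStarAlgebra.spectralOrder T.M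

theorem Topography.spectralOrderedRing (T : Topography A) :
    @StarOrderedRing T.M _ T.spectralOrder _ :=
  CStarAlgebra.spectralOrderedRing T.M

attribute [local instance] Topography.spectralOrder
attribute [local instance] Topography.spectralOrderedRing

theorem norm_bidualAct_le (G : Bidual A) (φ : StrongDual ℂ A) : ‖bidualAct G φ‖ ≤ ‖G‖ * ‖φ‖ := by
  refine ContinuousLinearMap.opNorm_le_bound _ (by positivity) fun a => ?_
  rw [bidualAct_apply, mul_assoc]
  refine (Bidual.le_opNorm G _).trans (mul_le_mul_of_nonneg_left ?_ (norm_nonneg _))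
  refine (ContinuousLinearMap.opNorm_comp_le _ _).trans ?_
  gcongr
  exact ContinuousLinearMap.opNorm_mul_apply_le ℂ A a

variable (T : Topography A) (K : TopologicalSpace.Compacts T.spectrum)

theorem Topography.tendsto_indicator (φ : StrongDual ℂ A) :
    Tendsto (fun g : Majorant K => φ ((g : T.M) : A)) atBot (𝓝 (T.indicator K φ)) :=
  tendsto_compactIndicator K (φ.comp T.inclusion)

theorem Topography.norm_indicator_apply_le (φ : StrongDual ℂ A) : ‖T.indicator K φ‖ ≤ ‖φ‖ :=
  le_of_tendsto (T.tendsto_indicator K φ).norm (Eventually.of_forall fun g =>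
    (φ.le_opNorm _).trans (mul_le_of_le_one_right (norm_nonneg _) g.2.2.1))

/-- Majorants have norm at most `1`, so the action of `1_K` is contractive; this keeps compression
contractive. -/
theorem Topography.norm_bidualAct_indicator_le (φ : StrongDual ℂ A) :
    ‖bidualAct (T.indicator K) φ‖ ≤ ‖φ‖ := by
  refine ContinuousLinearMap.opNorm_le_bound _ (norm_nonneg _) fun a => ?_
  rw [bidualAct_apply]
  refine (T.norm_indicator_apply_le K _).trans
    ((ContinuousLinearMap.opNorm_comp_le _ _).trans ?_)
  gcongr
  exact ContinuousLinearMap.opNorm_mul_apply_le ℂ A a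

theorem Topography.compress_apply (x : Bidual A) (φ : StrongDual ℂ A) :
    T.compress K x φ = T.indicator K (bidualAct x (bidualAct (T.indicator K) φ)) := rfl

theorem Topography.norm_compress_apply_le (x : Bidual A) (φ : StrongDual ℂ A) :
    ‖T.compress K x φ‖ ≤ ‖x‖ * ‖φ‖ := by
  rw [T.compress_apply]
  refine (T.norm_indicator_apply_le K _).trans ((norm_bidualAct_le _ _).trans ?_)
  gcongr
  exact T.norm_bidualAct_indicator_le K φ

theorem Topography.compress_sub_apply (x y : Bidual A) (φ : StrongDual ℂ A) :
    T.compress K (x - y) φ = T.compress K x φ - T.compress K y φ := by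
  simp only [T.compress_apply]
  rw [← map_sub]
  rfl

theorem Topography.compress_smul_apply (t : ℝ) (x : Bidual A) (φ : StrongDual ℂ A) :
    T.compress K (t • x) φ = t * T.compress K x φ := by
  simp only [T.compress_apply]
  rw [← smul_eq_mul, ← map_smul]
  rfl

theorem bidualAct_bidualOne (φ : StrongDual ℂ A) : bidualAct (bidualOne A) φ = φ :=
  ContinuousLinearMap.ext fun a => bidualOne_comp_mul φ a

/-- Compressing the unit gives the indicator function: `1_K 1 1_K = 1_K`. -/
theorem Topography.compress_bidualOne_apply (φ : StrongDual ℂ A) :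
    T.compress K (bidualOne A) φ = T.indicator K φ := by
  rw [T.compress_apply, bidualAct_bidualOne]
  -- This is the idempotence of `1_K`: each term of the net defining the outer factor already equals
  -- `T.indicator K φ`, since a majorant is absorbed by the inner `1_K`.
  refine tendsto_nhds_unique (T.tendsto_indicator K _) (tendsto_const_nhds.congr fun g => ?_)
  exact (compactIndicator_comp_mul g (φ.comp T.inclusion)).symm

variable {T K}

/-- Compression fixes the elements of `M` which are fixed by all majorants of `K`. -/
theorem Topography.compress_toBidual_apply {f : T.M} (hf : ∀ g : Majorant K, (g : T.M) * f = f)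
    (φ : StrongDual ℂ A) : T.compress K (toBidual (f : A)) φ = φ f := by
  have hf' : ∀ g : Majorant K, ((g : T.M) : A) * f = f := fun g => congrArg Subtype.val (hf g)
  have hf'' : ∀ g : Majorant K, (f : A) * (g : T.M) = f := fun g => by
    rw [T.comm_M _ f.2 _ (g : T.M).2, hf']
  -- Both factors `1_K` are removed by constant nets: the right one through `f * g = f`, then the
  -- left one through `g * f = f`.
  have h1 : bidualAct (T.indicator K) φ f = φ f := by
    refine tendsto_nhds_unique (T.tendsto_indicator K _) (tendsto_const_nhds.congr fun g => ?_)
    exact congrArg φ (hf'' g).symm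
  rw [T.compress_apply]
  refine tendsto_nhds_unique (T.tendsto_indicator K _) (tendsto_const_nhds.congr fun g => ?_)
  rw [← h1]
  exact congrArg (bidualAct (T.indicator K) φ) (hf' g).symm

/-- A state is positive on the Abelian subalgebra. -/
theorem Topography.apply_nonneg_of_mem_stateSpace {φ : StrongDual ℂ A} (hφ : φ ∈ stateSpace A)
    {m : T.M} (hm : 0 ≤ m) : 0 ≤ φ m := by
  obtain ⟨b, rfl⟩ := CStarAlgebra.nonneg_iff_eq_star_mul_self.1 hm
  exact hφ.1 b

theorem Topography.indicator_apply_le {φ : StrongDual ℂ A} (hφ : φ ∈ stateSpace A)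
    (f : Majorant K) : T.indicator K φ ≤ φ ((f : T.M) : A) :=
  le_of_tendsto (T.tendsto_indicator K φ) (by
    filter_upwards [eventually_le_atBot f] with g hg
    rw [← sub_nonneg, ← map_sub]
    exact T.apply_nonneg_of_mem_stateSpace hφ (sub_nonneg.2 hg))

theorem norm_apply_le_of_mem_stateSpace {φ : StrongDual ℂ A} (hφ : φ ∈ stateSpace A)
    (x : Bidual A) : ‖x φ‖ ≤ ‖x‖ := by
  have := Bidual.le_opNorm x φ
  rwa [hφ.2, mul_one] at this

/-- Realness matters because the domain of `L` is only a real space: `z - z(μ) 1` must remain in it.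
-/
theorem exists_real_apply_eq {φ : StrongDual ℂ A} (hφ : φ ∈ stateSpace A) (x : saUnitization A) :
    ∃ t : ℝ, (x : Bidual A) φ = t := by
  obtain ⟨a, ha, t, hx⟩ := x.2
  have h1 : star (φ a) = φ a := by rw [← apply_star_of_mem_stateSpace hφ, ha.star_eq]
  refine ⟨(φ a).re + t, ?_⟩
  rw [hx, Bidual.add_apply, Bidual.real_smul_apply, bidualOne_apply_of_mem_stateSpace hφ,
    toBidual_apply, mul_one, Complex.ofReal_add, Complex.conj_eq_iff_re.1 h1]

end Compression

/-! ### Tame sets are tight -/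

section Tame

variable {A : Type*} [NonUnitalCStarAlgebra A]

attribute [local instance] Topography.spectralOrder
attribute [local instance] Topography.spectralOrderedRing

theorem LipschitzPair.exists_mem_dom_eq_one (P : LipschitzPair A) :
    ∃ u : P.dom, ((u : saUnitization A) : Bidual A) = bidualOne A := by
  obtain ⟨h, -⟩ := (P.ker_eq ⟨bidualOne A, 0, IsSelfAdjoint.zero A, 1, by simp⟩).2 ⟨1, by simp⟩
  exact ⟨⟨_, h⟩, rfl⟩

/-- An element of the unitization which vanishes at a state can be approximated by elements of
the domain of `L` which vanish at that state. -/
theorem LipschitzPair.exists_mem_dom_apply_eq_zero (P : LipschitzPair A) {μ : StrongDual ℂ A}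
    (hμ : μ ∈ stateSpace A) (x : saUnitization A) (hx : (x : Bidual A) μ = 0) {δ : ℝ}
    (hδ : 0 < δ) : ∃ y : P.dom, ((y : saUnitization A) : Bidual A) μ = 0 ∧
      ‖(x : Bidual A) - (y : saUnitization A)‖ ≤ δ := by
  obtain ⟨z, hz, hxz⟩ := Metric.mem_closure_iff.1 (P.dense_dom x) (δ / 2) (half_pos hδ)
  obtain ⟨u, hu⟩ := P.exists_mem_dom_eq_one
  obtain ⟨t, ht⟩ := exists_real_apply_eq hμ z
  have hxz' : ‖(x : Bidual A) - z‖ < δ / 2 := by rwa [dist_eq_norm] at hxz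
  have htδ : |t| ≤ δ / 2 := by
    -- Since `x` vanishes at `μ`, the correction `t = z(μ)` is no larger than the approximation
    -- error; hence the halves of `δ`.
    have h1 := norm_apply_le_of_mem_stateSpace hμ ((x : Bidual A) - z)
    rw [Bidual.sub_apply, hx, ht, zero_sub, norm_neg, Complex.norm_real] at h1
    exact h1.trans hxz'.le
  have hy : (((⟨z, hz⟩ - t • u : P.dom) : saUnitization A) : Bidual A) =
      (z : Bidual A) - t • bidualOne A := by
    rw [← hu]; rfl
  refine ⟨⟨z, hz⟩ - t • u, ?_, ?_⟩
  · rw [hy, Bidual.sub_apply, Bidual.real_smul_apply, bidualOne_apply_of_mem_stateSpace hμ, ht,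
      mul_one, sub_self]
  · have hone : ‖bidualOne A‖ ≤ 1 :=
      ContinuousLinearMap.opNorm_le_bound _ zero_le_one fun φ => by
        rw [one_mul]; exact norm_bidualOne_apply_le φ
    calc _ = ‖((x : Bidual A) - z) + t • bidualOne A‖ := by rw [hy]; congr 1; abel
      _ ≤ ‖(x : Bidual A) - z‖ + ‖t • bidualOne A‖ := norm_add_le _ _
      _ ≤ δ / 2 + δ / 2 * 1 := by
        rw [norm_smul, Real.norm_eq_abs]
        gcongr
      _ = δ := by ring

/-- On a tame set, `φ (y - 1_K y 1_K)` is uniformly small for each `y` in the domain of `L` with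
`μ y = 0`. -/
theorem LipschitzTriple.exists_forall_norm_sub_compress_le (T : LipschitzTriple A)
    {𝒦 : Set (StrongDual ℂ A)} {μ : StrongDual ℂ A}
    (h : Tendsto (fun K : TopologicalSpace.Compacts T.spectrum =>
      ⨆ a ∈ T.lipBall μ, ⨆ φ ∈ 𝒦, ‖(a - T.compress K a) φ‖ₑ) atTop (𝓝 0))
    (y : T.dom) (hy : ((y : saUnitization A) : Bidual A) μ = 0) {δ : ℝ} (hδ : 0 < δ) :
    ∃ Q : TopologicalSpace.Compacts T.spectrum, ∀ K, Q ≤ K → ∀ φ ∈ 𝒦,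
      ‖((y : saUnitization A) : Bidual A) φ - T.compress K (y : saUnitization A) φ‖ ≤ δ := by
  -- Adding `1` keeps the scaling factor positive when `L y = 0`.
  set c : ℝ := T.L y + 1 with hc
  have hc0 : 0 < c := add_pos_of_nonneg_of_pos (apply_nonneg T.L y) one_pos
  have hmem : c⁻¹ • ((y : saUnitization A) : Bidual A) ∈ T.lipBall μ := by
    refine ⟨c⁻¹ • y, rfl, ?_, ?_⟩
    · rw [map_smul_eq_mul, norm_inv, Real.norm_of_nonneg hc0.le, inv_mul_le_one₀ hc0]
      linarith
    · rw [Bidual.real_smul_apply, hy, mul_zero]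
  have hpos : (0 : ℝ≥0∞) < ENNReal.ofReal (c⁻¹ * δ) := ENNReal.ofReal_pos.2 (by positivity)
  obtain ⟨Q, hQ⟩ := eventually_atTop.1 (h.eventually_lt_const hpos)
  refine ⟨Q, fun K hK φ hφ => ?_⟩
  have h1 := (le_iSup₂_of_le _ hmem (le_iSup₂_of_le φ hφ le_rfl)).trans (hQ K hK).le
  rw [Bidual.sub_apply, Bidual.real_smul_apply, T.compress_smul_apply, ← mul_sub,
    ← ofReal_norm, ENNReal.ofReal_le_ofReal_iff (by positivity), norm_mul, Complex.norm_real,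
    norm_inv, Real.norm_of_nonneg hc0.le] at h1
  exact le_of_mul_le_mul_left h1 (by positivity)

/-- On a tame set of states the numbers `φ (1 - 1_K)` are uniformly small. -/
theorem LipschitzTriple.IsTame.exists_forall_norm_le {T : LipschitzTriple A}
    {𝒦 : Set (StrongDual ℂ A)} (htame : T.IsTame 𝒦) (h𝒦 : 𝒦 ⊆ stateSpace A) {ε : ℝ}
    (hε : 0 < ε) : ∃ Q : TopologicalSpace.Compacts T.spectrum, ∀ K, Q ≤ K → ∀ φ ∈ 𝒦,
      ‖(bidualOne A - T.indicator K) φ‖ ≤ ε := by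
  obtain ⟨μ, ⟨hμ, K₀, hK₀⟩, hlim⟩ := htame
  obtain ⟨f, K₁, hf⟩ := exists_majorant_forall_mul_eq K₀
  have hμf : μ ((f : T.M) : A) = 1 := by
    -- `μ f` is squeezed between `μ(1_{K₀}) = 1` and `‖f‖ ≤ 1`.
    have h1 := Topography.indicator_apply_le hμ f
    rw [hK₀] at h1
    refine le_antisymm ?_ h1
    have h2 : ‖μ ((f : T.M) : A)‖ ≤ 1 :=
      (μ.le_opNorm _).trans (by rw [hμ.2, one_mul]; exact f.2.2.1)
    rw [Complex.eq_coe_norm_of_nonneg (zero_le_one.trans h1)]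
    exact_mod_cast h2
  have hsa : IsSelfAdjoint ((f : T.M) : A) :=
    congrArg Subtype.val f.2.1.isSelfAdjoint.star_eq
  let x : saUnitization A := ⟨bidualOne A - toBidual ((f : T.M) : A),
    -((f : T.M) : A), hsa.neg, 1, by rw [map_neg, one_smul]; abel⟩
  have hx : (x : Bidual A) μ = 0 := by
    change (bidualOne A - toBidual ((f : T.M) : A)) μ = 0
    rw [Bidual.sub_apply, bidualOne_apply_of_mem_stateSpace hμ, toBidual_apply, hμf, sub_self]
  -- Of the three errors `ε / 3`, two come from replacing `x` by `y`, outside and inside the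
  -- compression, and one from tameness at `y`.
  obtain ⟨y, hyμ, hxy⟩ := T.exists_mem_dom_apply_eq_zero hμ x hx (show 0 < ε / 3 by positivity)
  obtain ⟨Q, hQ⟩ := T.exists_forall_norm_sub_compress_le hlim y hyμ (show 0 < ε / 3 by positivity)
  refine ⟨Q ⊔ K₁, fun K hK φ hφ => ?_⟩
  set z : Bidual A := ((y : saUnitization A) : Bidual A)
  have hfix : ∀ g : Majorant K, (g : T.M) * f = f := fun g =>
    hf g fun s hs => g.2.2.2 s ((le_sup_right.trans hK : K₁ ≤ K) hs)
  -- The terms in `f` cancel because compression to `K` fixes `f`.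
  have heq : (bidualOne A - T.indicator K) φ = (x : Bidual A) φ - T.compress K x φ := by
    change _ = (bidualOne A - toBidual ((f : T.M) : A)) φ -
      T.compress K (bidualOne A - toBidual ((f : T.M) : A)) φ
    rw [T.compress_sub_apply, T.compress_bidualOne_apply, Topography.compress_toBidual_apply hfix,
      Bidual.sub_apply, Bidual.sub_apply, toBidual_apply]
    ring
  have h1 : ‖((x : Bidual A) - z) φ‖ ≤ ε / 3 :=
    (norm_apply_le_of_mem_stateSpace (h𝒦 hφ) _).trans hxy
  have h2 : ‖T.compress K ((x : Bidual A) - z) φ‖ ≤ ε / 3 := by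
    refine (T.norm_compress_apply_le K _ φ).trans ?_
    rw [(h𝒦 hφ).2, mul_one]
    exact hxy
  have h3 : ‖z φ - T.compress K z φ‖ ≤ ε / 3 := hQ K (le_sup_left.trans hK) φ hφ
  have hsplit : (x : Bidual A) φ - T.compress K x φ =
      ((x : Bidual A) - z) φ - T.compress K ((x : Bidual A) - z) φ +
        (z φ - T.compress K z φ) := by
    rw [T.compress_sub_apply K (x : Bidual A) z φ, Bidual.sub_apply (x : Bidual A) z φ]
    ring
  rw [heq, hsplit]
  linarith [norm_add_le (((x : Bidual A) - z) φ - T.compress K ((x : Bidual A) - z) φ)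
    (z φ - T.compress K z φ), norm_sub_le (((x : Bidual A) - z) φ)
    (T.compress K ((x : Bidual A) - z) φ)]

theorem LipschitzTriple.IsTame.isTight {T : LipschitzTriple A}
    {𝒦 : Set (StrongDual ℂ A)} (htame : T.IsTame 𝒦) (h𝒦 : 𝒦 ⊆ stateSpace A) : T.IsTight 𝒦 := by
  intro ε hε
  -- A real `δ` strictly below `ε` keeps the supremum strictly below `ε`, and also covers `ε = ∞`.
  obtain ⟨δ, hδ0, hδ⟩ : ∃ δ : ℝ, 0 < δ ∧ ENNReal.ofReal δ < ε := by
    obtain ⟨r, -, hr0, hr⟩ := ENNReal.lt_iff_exists_real_btwn.1 hε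
    exact ⟨r, ENNReal.ofReal_pos.1 hr0, hr⟩
  obtain ⟨Q, hQ⟩ := htame.exists_forall_norm_le h𝒦 hδ0
  refine ⟨Q, fun K hK => (iSup₂_le fun φ hφ => ?_).trans_lt hδ⟩
  rw [← ofReal_norm]
  exact ENNReal.ofReal_le_ofReal (hQ K hK φ hφ)

/-! ### Weak* closures of tight sets -/

theorem toWeakDual_image_subset_closedBall {𝒦 : Set (StrongDual ℂ A)} (h𝒦 : 𝒦 ⊆ stateSpace A) :
    StrongDual.toWeakDual '' 𝒦 ⊆
      WeakDual.toStrongDual ⁻¹' Metric.closedBall (0 : StrongDual ℂ A) 1 := by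
  rintro _ ⟨φ, hφ, rfl⟩
  exact mem_closedBall_zero_iff.2 (h𝒦 hφ).2.le

/-- Banach–Alaoglu; tightness plays no role here. -/
theorem isCompact_closure_toWeakDual_image {𝒦 : Set (StrongDual ℂ A)} (h𝒦 : 𝒦 ⊆ stateSpace A) :
    IsCompact (closure (StrongDual.toWeakDual '' 𝒦 : Set (WeakDual ℂ A))) :=
  (WeakDual.isCompact_closedBall (0 : StrongDual ℂ A) 1).closure_of_subset
    (toWeakDual_image_subset_closedBall h𝒦)

theorem Topography.IsTight.closure_subset {T : Topography A} {𝒦 : Set (StrongDual ℂ A)}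
    (htight : T.IsTight 𝒦) (h𝒦 : 𝒦 ⊆ stateSpace A) :
    closure (StrongDual.toWeakDual '' 𝒦 : Set (WeakDual ℂ A)) ⊆
      StrongDual.toWeakDual '' stateSpace A := by
  intro φ hφ
  have hpos : ∀ a : A, 0 ≤ φ (star a * a) := fun a => by
    refine closure_minimal ?_ (isClosed_le continuous_const (WeakDual.eval_continuous _)) hφ
    rintro _ ⟨ψ, hψ, rfl⟩
    exact (h𝒦 hψ).1 a
  have hle : ‖WeakDual.toStrongDual φ‖ ≤ 1 := by
    rw [← mem_closedBall_zero_iff]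
    exact closure_minimal (toWeakDual_image_subset_closedBall h𝒦)
      (WeakDual.isClosed_closedBall _ _) hφ
  have hge : ∀ ε : ℝ, 0 < ε → 1 ≤ ‖WeakDual.toStrongDual φ‖ + ε := by
    intro ε hε
    obtain ⟨Q, hQ⟩ := htight (ENNReal.ofReal ε) (ENNReal.ofReal_pos.2 hε)
    obtain ⟨f⟩ : Nonempty (Majorant Q) := inferInstance
    -- The indicator of `Q` need not be weak* continuous on the dual of `A`; its majorant `f` lies
    -- in `A`, so the lower bound `1 - ε` passes to the closure.
    have h1 : 1 - ε ≤ (φ ((f : T.M) : A)).re := by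
      refine closure_minimal ?_ (isClosed_le continuous_const
        (Complex.continuous_re.comp (WeakDual.eval_continuous ((f : T.M) : A)))) hφ
      rintro _ ⟨ψ, hψ, rfl⟩
      have h2 := (le_iSup₂_of_le (f := fun (φ : StrongDual ℂ A) (_ : φ ∈ 𝒦) =>
        ‖(bidualOne A - T.indicator Q) φ‖ₑ) ψ hψ le_rfl).trans (hQ Q le_rfl).le
      rw [← ofReal_norm, ENNReal.ofReal_le_ofReal_iff hε.le, Bidual.sub_apply,
        bidualOne_apply_of_mem_stateSpace (h𝒦 hψ)] at h2
      have h3 := (Complex.re_le_norm _).trans h2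
      have h4 := (Complex.le_def.1 (T.indicator_apply_le (h𝒦 hψ) f)).1
      rw [Complex.sub_re, Complex.one_re] at h3
      change 1 - ε ≤ (ψ ((f : T.M) : A)).re
      linarith
    have h5 : ‖φ ((f : T.M) : A)‖ ≤ ‖WeakDual.toStrongDual φ‖ :=
      ((WeakDual.toStrongDual φ).le_opNorm _).trans
        (mul_le_of_le_one_right (norm_nonneg _) f.2.2.1)
    linarith [Complex.re_le_norm (φ ((f : T.M) : A))]
  exact ⟨WeakDual.toStrongDual φ, ⟨hpos, le_antisymm hle (le_of_forall_pos_le_add hge)⟩, rfl⟩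

end Tame

end QuantumMetric

theorem mainTheorem5 {A : Type*} [NonUnitalCStarAlgebra A]
    (T : QuantumMetric.LipschitzTriple A) (𝒦 : Set (StrongDual ℂ A))
    (h𝒦 : 𝒦 ⊆ QuantumMetric.stateSpace A) (htame : T.IsTame 𝒦) :
    T.IsTight 𝒦 ∧
      IsCompact (closure (StrongDual.toWeakDual '' 𝒦 : Set (WeakDual ℂ A))) ∧
      closure (StrongDual.toWeakDual '' 𝒦 : Set (WeakDual ℂ A)) ⊆
        StrongDual.toWeakDual '' QuantumMetric.stateSpace A :=
  ⟨htame.isTight h𝒦, QuantumMetric.isCompact_closure_toWeakDual_image h𝒦,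
    (htame.isTight h𝒦).closure_subset h𝒦⟩
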